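/- Let $n\ge 0$. Let $STVB_n$ be the singular twisted virtual braid monoid on $n$ strands, i.e. the monoid with generators $\sigma_i,\sigma_i^{-1},\rho_i,\tau_i$ $(1\le i\le n-1)$ and $\gamma_j$ $(1\le j\le n)$ and, with $e$ the identity element, the following defining relations, for all values of the indices for which they make sense: $$\sigma_i\sigma_i^{-1}=\sigma_i^{-1}\sigma_i=e,\qquad \rho_i^2=e,\qquad \gamma_i^2=e,\qquad \gamma_i\gamma_j=\gamma_j\gamma_i;$$ $$\sigma_i\sigma_j=\sigma_j\sigma_i,\quad \rho_i\rho_j=\rho_j\rho_i,\quad \tau_i\tau_j=\tau_j\tau_i,\quad \sigma_i\rho_j=\rho_j\sigma_i,\quad \sigma_i\tau_j=\tau_j\sigma_i,\quad \tau_i\rho_j=\rho_j\tau_i\qquad(|i-j|>1);$$ $$\sigma_i\sigma_{i+1}\sigma_i=\sigma_{i+1}\sigma_i\sigma_{i+1},\quad \rho_i\rho_{i+1}\rho_i=\rho_{i+1}\rho_i\rho_{i+1},\quad \rho_i\sigma_{i+1}\rho_i=\rho_{i+1}\sigma_i\rho_{i+1},\quad \rho_i\tau_{i+1}\rho_i=\rho_{i+1}\tau_i\rho_{i+1};$$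 $$\sigma_i\tau_i=\tau_i\sigma_i,\quad \sigma_i\sigma_{i+1}\tau_i=\tau_{i+1}\sigma_i\sigma_{i+1},\quad \sigma_{i+1}\sigma_i\tau_{i+1}=\tau_i\sigma_{i+1}\sigma_i;$$ $$\gamma_j\rho_i=\rho_i\gamma_j,\quad \sigma_i\gamma_j=\gamma_j\sigma_i,\quad \tau_i\gamma_j=\gamma_j\tau_i\qquad(j\ne i,i+1);$$ $$\gamma_{i+1}\rho_i=\rho_i\gamma_i,\quad \rho_i\sigma_i\rho_i=\gamma_{i+1}\gamma_i\sigma_i\gamma_i\gamma_{i+1},\quad \rho_i\tau_i\rho_i=\gamma_{i+1}\gamma_i\tau_i\gamma_i\gamma_{i+1}.$$ Let $\varphi_2\colon STVB_n\to S_n$ be the homomorphism that sends $\rho_i$ to the transposition $(i,i+1)$ and all $\sigma_i^{\pm1}$, $\tau_i$, $\gamma_j$ to the identity, and let $STVH_n=\ker(\varphi_2)=\{w\in STVB_n : \varphi_2(w)=e\}$. For $1\le i<j\le n$ put $$x_{ij}^{\pm1}=\rho_{j-1}\cdots\rho_{i+1}\,\sigma_i^{\pm1}\,\rho_{i+1}\cdots\rho_{j-1},\qquad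 x_{ji}^{\pm1}=\rho_{j-1}\cdots\rho_{i+1}\rho_i\,\sigma_i^{\pm1}\,\rho_i\rho_{i+1}\cdots\rho_{j-1},$$ $$z_{ij}=\rho_{j-1}\cdots\rho_{i+1}\,\tau_i\,\rho_{i+1}\cdots\rho_{j-1},\qquad z_{ji}=\rho_{j-1}\cdots\rho_{i+1}\rho_i\,\tau_i\,\rho_i\rho_{i+1}\cdots\rho_{j-1}.$$ **Theorem.** The elements $x_{kl},x_{kl}^{-1},z_{kl}$ $(1\le k\ne l\le n)$ and $\gamma_j$ $(1\le j\le n)$ lie in $STVH_n$, and the monoid $STVH_n$ has a presentation with these generators and the following defining relations, in which different letters denote different indices in $\{1,\dots,n\}$: $$\gamma_i^2=e,\qquad \gamma_i\gamma_j=\gamma_j\gamma_i,\qquad x_{ij}x_{ij}^{-1}=x_{ij}^{-1}x_{ij}=e,$$ $$x_{ij}x_{kl}=x_{kl}x_{ij},\qquad x_{ik}x_{kj}x_{ik}=x_{kj}x_{ik}x_{kj},\qquad x_{ij}\gamma_k=\gamma_kx_{ij},\qquad x_{ij}=\gamma_i\gamma_jx_{ji}\gamma_j\gamma_i,$$ $$x_{ij}z_{kl}=z_{kl}x_{ij},\qquad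 x_{ik}x_{kj}z_{ik}=z_{kj}x_{ik}x_{kj},\qquad z_{ik}x_{kj}x_{ik}=x_{kj}x_{ik}z_{kj},\qquad x_{ij}z_{ij}=z_{ij}x_{ij},$$ $$z_{ij}z_{kl}=z_{kl}z_{ij},\qquad z_{ij}\gamma_k=\gamma_kz_{ij},\qquad z_{ij}=\gamma_i\gamma_jz_{ji}\gamma_j\gamma_i.$$ That is, the homomorphism from the monoid so presented to $STVB_n$ that sends each generating symbol to the element of the same name is injective with image $STVH_n$. -/

import Mathlib

/-! Singular twisted virtual braids on `n` strands.  Strands are numbered `0, …, n - 1` (elements of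
`Fin n`), and the crossing generators with index `i : Fin (n - 1)` involve the strands
`i` and `i + 1`. -/

/-- The first strand involved in the crossing number `i`. -/
def crossLo {n : ℕ} (i : Fin (n - 1)) : Fin n := ⟨i, by omega⟩

/-- The second strand involved in the crossing number `i`. -/
def crossHi {n : ℕ} (i : Fin (n - 1)) : Fin n := ⟨i + 1, by omega⟩

/-- `|i - j| > 1`. -/
def CrossFar {n : ℕ} (i j : Fin (n - 1)) : Prop := (i : ℕ) + 1 < j ∨ (j : ℕ) + 1 < i

/-- The standard generators `σ_i`, `σ_i⁻¹`, `ρ_i`, `τ_i` and `γ_j`. -/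
inductive STVBGen (n : ℕ) : Type
  | sigma (i : Fin (n - 1))
  | sigmaInv (i : Fin (n - 1))
  | rho (i : Fin (n - 1))
  | tau (i : Fin (n - 1))
  | gamma (j : Fin n)

namespace STVBGen

/-- The generator `σ_i` as a word. -/
abbrev s {n : ℕ} (i : Fin (n - 1)) : FreeMonoid (STVBGen n) := FreeMonoid.of (sigma i)

/-- The generator `σ_i⁻¹` as a word. -/
abbrev s' {n : ℕ} (i : Fin (n - 1)) : FreeMonoid (STVBGen n) := FreeMonoid.of (sigmaInv i)

/-- The generator `ρ_i` as a word. -/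
abbrev r {n : ℕ} (i : Fin (n - 1)) : FreeMonoid (STVBGen n) := FreeMonoid.of (rho i)

/-- The generator `τ_i` as a word. -/
abbrev t {n : ℕ} (i : Fin (n - 1)) : FreeMonoid (STVBGen n) := FreeMonoid.of (tau i)

/-- The generator `γ_j` as a word. -/
abbrev g {n : ℕ} (j : Fin n) : FreeMonoid (STVBGen n) := FreeMonoid.of (gamma j)

end STVBGen

open STVBGen in
/-- The defining relations of the singular twisted virtual braid monoid.  In relations that
involve consecutive crossings, `j` stands for `i + 1`. -/
inductive STVBRel (n : ℕ) : FreeMonoid (STVBGen n) → FreeMonoid (STVBGen n) → Prop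
  | sigma_comm (i j : Fin (n - 1)) (h : CrossFar i j) : STVBRel n (s i * s j) (s j * s i)
  | sigma_braid (i j : Fin (n - 1)) (h : (i : ℕ) + 1 = j) :
      STVBRel n (s i * s j * s i) (s j * s i * s j)
  | rho_sq (i : Fin (n - 1)) : STVBRel n (r i * r i) 1
  | rho_comm (i j : Fin (n - 1)) (h : CrossFar i j) : STVBRel n (r i * r j) (r j * r i)
  | rho_braid (i j : Fin (n - 1)) (h : (i : ℕ) + 1 = j) :
      STVBRel n (r i * r j * r i) (r j * r i * r j)
  | sigma_rho_comm (i j : Fin (n - 1)) (h : CrossFar i j) : STVBRel n (s i * r j) (r j * s i)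
  | rho_sigma_rho (i j : Fin (n - 1)) (h : (i : ℕ) + 1 = j) :
      STVBRel n (r i * s j * r i) (r j * s i * r j)
  | gamma_sq (i : Fin n) : STVBRel n (g i * g i) 1
  | gamma_comm (i j : Fin n) : STVBRel n (g i * g j) (g j * g i)
  | gamma_rho_comm (i : Fin (n - 1)) (j : Fin n) (h₁ : j ≠ crossLo i) (h₂ : j ≠ crossHi i) :
      STVBRel n (g j * r i) (r i * g j)
  | sigma_gamma_comm (i : Fin (n - 1)) (j : Fin n) (h₁ : j ≠ crossLo i) (h₂ : j ≠ crossHi i) :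
      STVBRel n (s i * g j) (g j * s i)
  | gamma_rho (i : Fin (n - 1)) : STVBRel n (g (crossHi i) * r i) (r i * g (crossLo i))
  | rho_sigma_twist (i : Fin (n - 1)) :
      STVBRel n (r i * s i * r i)
        (g (crossHi i) * g (crossLo i) * s i * g (crossLo i) * g (crossHi i))
  | sigma_mul_inv (i : Fin (n - 1)) : STVBRel n (s i * s' i) 1
  | sigma_inv_mul (i : Fin (n - 1)) : STVBRel n (s' i * s i) 1
  | tau_comm (i j : Fin (n - 1)) (h : CrossFar i j) : STVBRel n (t i * t j) (t j * t i)
  | sigma_tau_comm (i j : Fin (n - 1)) (h : CrossFar i j) : STVBRel n (s i * t j) (t j * s i)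
  | sigma_tau (i : Fin (n - 1)) : STVBRel n (s i * t i) (t i * s i)
  | sigma_sigma_tau (i j : Fin (n - 1)) (h : (i : ℕ) + 1 = j) :
      STVBRel n (s i * s j * t i) (t j * s i * s j)
  | sigma_sigma_tau' (i j : Fin (n - 1)) (h : (i : ℕ) + 1 = j) :
      STVBRel n (s j * s i * t j) (t i * s j * s i)
  | tau_rho_comm (i j : Fin (n - 1)) (h : CrossFar i j) : STVBRel n (t i * r j) (r j * t i)
  | rho_tau_rho (i j : Fin (n - 1)) (h : (i : ℕ) + 1 = j) :
      STVBRel n (r i * t j * r i) (r j * t i * r j)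
  | tau_gamma_comm (i : Fin (n - 1)) (j : Fin n) (h₁ : j ≠ crossLo i) (h₂ : j ≠ crossHi i) :
      STVBRel n (t i * g j) (g j * t i)
  | rho_tau_twist (i : Fin (n - 1)) :
      STVBRel n (r i * t i * r i)
        (g (crossHi i) * g (crossLo i) * t i * g (crossLo i) * g (crossHi i))

/-- The singular twisted virtual braid monoid on `n` strands. -/
abbrev STVB (n : ℕ) : Type := PresentedMonoid (STVBRel n)

namespace STVB

/-- The element `σ_i`. -/
def sigma {n : ℕ} (i : Fin (n - 1)) : STVB n := PresentedMonoid.of _ (STVBGen.sigma i)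

/-- The element `σ_i⁻¹`. -/
def sigmaInv {n : ℕ} (i : Fin (n - 1)) : STVB n := PresentedMonoid.of _ (STVBGen.sigmaInv i)

/-- The element `ρ_i`. -/
def rho {n : ℕ} (i : Fin (n - 1)) : STVB n := PresentedMonoid.of _ (STVBGen.rho i)

/-- The element `τ_i`. -/
def tau {n : ℕ} (i : Fin (n - 1)) : STVB n := PresentedMonoid.of _ (STVBGen.tau i)

/-- The element `γ_j`. -/
def gamma {n : ℕ} (j : Fin n) : STVB n := PresentedMonoid.of _ (STVBGen.gamma j)

/-- The values of `φ₂` on the generators: `ρ_i` goes to the transposition `(i, i + 1)`, every other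
generator goes to the identity. -/
def phi₂Gen {n : ℕ} : STVBGen n → Equiv.Perm (Fin n)
  | STVBGen.rho i => Equiv.swap (crossLo i) (crossHi i)
  | _ => 1

theorem phi₂Gen_rel {n : ℕ} (a b : FreeMonoid (STVBGen n)) (h : STVBRel n a b) :
    FreeMonoid.lift phi₂Gen a = FreeMonoid.lift phi₂Gen b := by
  cases h
  case rho_comm i j h =>
    simp only [map_mul, FreeMonoid.lift_eval_of, phi₂Gen]
    refine (Equiv.Perm.Disjoint.commute ?_).eq
    intro x
    simp only [CrossFar] at h
    by_cases hx : x = crossLo i ∨ x = crossHi i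
    · right
      apply Equiv.swap_apply_of_ne_of_ne <;>
        · simp only [crossLo, crossHi, Fin.ext_iff, ne_eq] at hx ⊢
          omega
    · left
      push Not at hx
      exact Equiv.swap_apply_of_ne_of_ne hx.1 hx.2
  case rho_braid i j h =>
    simp only [map_mul, FreeMonoid.lift_eval_of, phi₂Gen]
    have e : crossHi i = crossLo j := by simp [crossLo, crossHi, h]
    have h₁ : crossLo i ≠ crossLo j := by simp [crossLo]; omega
    have h₂ : crossLo i ≠ crossHi j := by simp [crossLo, crossHi]; omega
    have h₃ : crossLo j ≠ crossHi j := by simp [crossLo, crossHi]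
    rw [e, Equiv.swap_mul_swap_mul_swap h₁ h₂, Equiv.swap_comm (crossLo i),
      Equiv.swap_comm (crossLo j) (crossHi j), Equiv.swap_mul_swap_mul_swap h₃.symm h₂.symm,
      Equiv.swap_comm]
  all_goals simp [phi₂Gen]

/-- The homomorphism `φ₂ : STVB_n → S_n`. -/
def phi₂ (n : ℕ) : STVB n →* Equiv.Perm (Fin n) :=
  PresentedMonoid.lift phi₂Gen phi₂Gen_rel

/-- The kernel `{w | φ₂ w = 1}` of `φ₂`. -/
def STVH (n : ℕ) : Submonoid (STVB n) := MonoidHom.mker (phi₂ n)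

/-- The list `ρ_{i+1}, ρ_{i+2}, …, ρ_{j-1}` (empty unless `i + 1 < j`). -/
def rhoList {n : ℕ} (i j : Fin n) : List (STVB n) :=
  List.ofFn fun m : Fin ((j : ℕ) - i - 1) => rho ⟨(i : ℕ) + 1 + m, by omega⟩

/-- Given elements `a_i` indexed by crossings, the element
`a_{k,l} = ρ_{l-1} ⋯ ρ_{k+1} a_k ρ_{k+1} ⋯ ρ_{l-1}` for `k < l` and
`a_{k,l} = ρ_{k-1} ⋯ ρ_{l+1} ρ_l a_l ρ_l ρ_{l+1} ⋯ ρ_{k-1}` for `l < k`. -/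
def strandPair {n : ℕ} (a : Fin (n - 1) → STVB n) (k l : Fin n) (h : k ≠ l) : STVB n :=
  if hkl : k < l then
    (rhoList k l).reverse.prod * a ⟨k, by omega⟩ * (rhoList k l).prod
  else
    (rhoList l k).reverse.prod *
      (rho ⟨l, by omega⟩ * a ⟨l, by omega⟩ * rho ⟨l, by omega⟩) * (rhoList l k).prod

/-- The element `x_{k,l}`. -/
def x {n : ℕ} (k l : Fin n) (h : k ≠ l) : STVB n := strandPair sigma k l h

/-- The element `x_{k,l}⁻¹`. -/
def xInv {n : ℕ} (k l : Fin n) (h : k ≠ l) : STVB n := strandPair sigmaInv k l h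

/-- The element `z_{k,l}`. -/
def z {n : ℕ} (k l : Fin n) (h : k ≠ l) : STVB n := strandPair tau k l h

end STVB

/-- The generating symbols `x_{k,l}`, `x_{k,l}⁻¹`, `z_{k,l}` for `k ≠ l`, and `γ_j`. -/
inductive STVHGen (n : ℕ) : Type
  | x (k l : Fin n) (h : k ≠ l)
  | xInv (k l : Fin n) (h : k ≠ l)
  | z (k l : Fin n) (h : k ≠ l)
  | gamma (j : Fin n)

namespace STVHGen

/-- The symbol `x_{k,l}` as a word. -/
abbrev X {n : ℕ} (k l : Fin n) (h : k ≠ l) : FreeMonoid (STVHGen n) := FreeMonoid.of (x k l h)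

/-- The symbol `x_{k,l}⁻¹` as a word. -/
abbrev X' {n : ℕ} (k l : Fin n) (h : k ≠ l) : FreeMonoid (STVHGen n) := FreeMonoid.of (xInv k l h)

/-- The symbol `z_{k,l}` as a word. -/
abbrev Z {n : ℕ} (k l : Fin n) (h : k ≠ l) : FreeMonoid (STVHGen n) := FreeMonoid.of (z k l h)

/-- The symbol `γ_j` as a word. -/
abbrev G {n : ℕ} (j : Fin n) : FreeMonoid (STVHGen n) := FreeMonoid.of (gamma j)

/-- The element of `STVB_n` that a generating symbol stands for. -/
def toSTVB {n : ℕ} : STVHGen n → STVB n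
  | x k l h => STVB.x k l h
  | xInv k l h => STVB.xInv k l h
  | z k l h => STVB.z k l h
  | gamma j => STVB.gamma j

end STVHGen

open STVHGen in
/-- The relations of the presentation; indices denoted by different letters are different, except
in `γ_i γ_j = γ_j γ_i`, where this makes no difference. -/
inductive STVHRel (n : ℕ) : FreeMonoid (STVHGen n) → FreeMonoid (STVHGen n) → Prop
  | gamma_sq (i : Fin n) : STVHRel n (G i * G i) 1
  | gamma_comm (i j : Fin n) : STVHRel n (G i * G j) (G j * G i)
  | x_mul_inv (i j : Fin n) (hij : i ≠ j) : STVHRel n (X i j hij * X' i j hij) 1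
  | x_inv_mul (i j : Fin n) (hij : i ≠ j) : STVHRel n (X' i j hij * X i j hij) 1
  | x_x_comm (i j k l : Fin n) (hij : i ≠ j) (hkl : k ≠ l)
      (hik : i ≠ k) (hil : i ≠ l) (hjk : j ≠ k) (hjl : j ≠ l) :
      STVHRel n (X i j hij * X k l hkl) (X k l hkl * X i j hij)
  | x_braid (i j k : Fin n) (hij : i ≠ j) (hik : i ≠ k) (hkj : k ≠ j) :
      STVHRel n (X i k hik * X k j hkj * X i k hik) (X k j hkj * X i k hik * X k j hkj)
  | x_gamma_comm (i j k : Fin n) (hij : i ≠ j) (hik : i ≠ k) (hjk : j ≠ k) :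
      STVHRel n (X i j hij * G k) (G k * X i j hij)
  | x_twist (i j : Fin n) (hij : i ≠ j) :
      STVHRel n (X i j hij) (G i * G j * X j i hij.symm * G j * G i)
  | x_z_comm (i j k l : Fin n) (hij : i ≠ j) (hkl : k ≠ l)
      (hik : i ≠ k) (hil : i ≠ l) (hjk : j ≠ k) (hjl : j ≠ l) :
      STVHRel n (X i j hij * Z k l hkl) (Z k l hkl * X i j hij)
  | x_x_z (i j k : Fin n) (hij : i ≠ j) (hik : i ≠ k) (hkj : k ≠ j) :
      STVHRel n (X i k hik * X k j hkj * Z i k hik) (Z k j hkj * X i k hik * X k j hkj)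
  | z_x_x (i j k : Fin n) (hij : i ≠ j) (hik : i ≠ k) (hkj : k ≠ j) :
      STVHRel n (Z i k hik * X k j hkj * X i k hik) (X k j hkj * X i k hik * Z k j hkj)
  | x_z (i j : Fin n) (hij : i ≠ j) :
      STVHRel n (X i j hij * Z i j hij) (Z i j hij * X i j hij)
  | z_z_comm (i j k l : Fin n) (hij : i ≠ j) (hkl : k ≠ l)
      (hik : i ≠ k) (hil : i ≠ l) (hjk : j ≠ k) (hjl : j ≠ l) :
      STVHRel n (Z i j hij * Z k l hkl) (Z k l hkl * Z i j hij)
  | z_gamma_comm (i j k : Fin n) (hij : i ≠ j) (hik : i ≠ k) (hjk : j ≠ k) :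
      STVHRel n (Z i j hij * G k) (G k * Z i j hij)
  | z_twist (i j : Fin n) (hij : i ≠ j) :
      STVHRel n (Z i j hij) (G i * G j * Z j i hij.symm * G j * G i)

/-! In effect the monoid is a semidirect product of the presented monoid `H` by the symmetric group
generated by the `ρ_i`, and `φ₂` is the projection onto the second factor.

The map `H → STVB n` is well defined because conjugation by `ρ_m` permutes the indices of `x_{kl}`,
`z_{kl}`, `γ_j` by the transposition `(m, m + 1)` (`conj_eq_swap`, `IsCrossing.conj_rho`,
`conj_rho_gamma`). As transpositions generate all permutations, every relation of `H` is a
relabelling of one relation between crossings near the first strands, and that one is a defining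
relation of `STVB n` or immediate from it (`toSTVB_rel`).

For injectivity, `STVB n` acts on the set `H`: `ρ_i` permutes indices, the other generators multiply
on the left (`actGen_rel`). The image of `h` in `STVB n` then acts as left multiplication by `h`, so
`h` is recovered as the image of `1`.

For surjectivity onto the kernel, every `ρ_i` can be pushed to the right, so each element is the
image of some `h` times a word in the `ρ_i` (`exists_eq_ofPresented_mul`). On the kernel of `φ₂`
this word has trivial permutation; since the `ρ_i` satisfy the Coxeter relations of `S_n`, it equals
`1` (`eq_one_of_phi₂_eq_one`). -/

/-! ### Conjugation by involutions as permutation of indices -/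

/-- Conjugating a family `F k l`, built from `b` by successive conjugations by the involutions
`r l`, by `r m` permutes the indices by the transposition `(m, m + 1)`. -/
theorem conj_eq_swap {M : Type*} [Monoid M] {N : ℕ} {r b : ℕ → M} {F : ℕ → ℕ → M}
    (hsq : ∀ i < N, r i * r i = 1)
    (hcomm : ∀ i j, i + 1 < j → j < N → r i * r j = r j * r i)
    (hbraid : ∀ i, i + 1 < N → r i * r (i + 1) * r i = r (i + 1) * r i * r (i + 1))
    (hb : ∀ i j, i < N → j < N → (i + 1 < j ∨ j + 1 < i) → r i * b j = b j * r i)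
    (hmixed : ∀ i, i + 1 < N → r i * b (i + 1) * r i = r (i + 1) * b i * r (i + 1))
    (hF₀ : ∀ k < N, F k (k + 1) = b k)
    (hF₁ : ∀ k l, k < l → l < N → F k (l + 1) = r l * F k l * r l)
    (l : ℕ) : ∀ k m, k < l → l ≤ N → m < N → ¬ (k = m ∧ l = m + 1) →
      r m * F k l * r m = F (Equiv.swap m (m + 1) k) (Equiv.swap m (m + 1) l) := by
  have conj_far : ∀ i x, i < N → r i * x = x * r i → r i * x * r i = x := by
    intro i x hi h
    rw [h, mul_assoc, hsq i hi, mul_one]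
  have hsw : ∀ m k, Equiv.swap m (m + 1) k = if k = m then m + 1 else if k = m + 1 then m else k :=
    fun m k => Equiv.swap_apply_def m (m + 1) k
  have hinv : ∀ i x, i < N → r i * (r i * x * r i) * r i = x := by
    intro i x hi
    calc _ = (r i * r i) * x * (r i * r i) := by simp only [mul_assoc]
      _ = x := by rw [hsq i hi, one_mul, mul_one]
  -- The case distinction is on the position of `m` relative to the upper index. The excluded pair
  -- `(m, m + 1)` would be sent to `F (m + 1) m`, about which the hypotheses say nothing. Strong
  -- induction is needed because the case that uses the braid relation descends by two.
  induction l using Nat.strong_induction_on with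
  | _ l ih =>
    intro k m hkl hl hm hne
    obtain ⟨l, rfl⟩ : ∃ p, l = p + 1 := ⟨l - 1, by omega⟩
    by_cases hml : m = l + 1
    · subst hml
      rw [hsw, hsw, if_neg (by omega), if_neg (by omega), if_pos rfl,
        hF₁ k (l + 1) hkl hm]
    rcases Nat.lt_or_ge k l with hk | hk
    · rw [hF₁ k l hk hl]
      by_cases hm₁ : m = l
      · subst hm₁
        rw [hinv _ _ hm, hsw, hsw, if_neg (by omega), if_neg (by omega), if_neg (by omega),
          if_pos rfl]
      by_cases hm₂ : m + 1 = l
      · subst hm₂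
        rw [hsw m (m + 1 + 1), if_neg (by omega), if_neg (by omega)]
        rcases Nat.lt_or_ge k m with hkm | hkm
        -- The transposition `(m + 1, m + 2)` fixes `k` and `m`, so `h₁` says that conjugation by `r
        -- (m + 1)` fixes `F k m`; the braid relation brings this conjugation to the inside.
        · have h₁ := ih m (by omega) k (m + 1) hkm (by omega) (by omega) (by omega)
          rw [hsw, hsw, if_neg (by omega), if_neg (by omega), if_neg (by omega),
            if_neg (by omega)] at h₁
          rw [hsw, if_neg (by omega), if_neg (by omega), hF₁ k (m + 1) (by omega) hl,
            hF₁ k m hkm hm]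
          calc _ = (r m * r (m + 1) * r m) * F k m * (r m * r (m + 1) * r m) := by
                simp only [mul_assoc]
            _ = r (m + 1) * r m * (r (m + 1) * F k m * r (m + 1)) * r m * r (m + 1) := by
                rw [hbraid m hl]; simp only [mul_assoc]
            _ = _ := by rw [h₁]; simp only [mul_assoc]
        · obtain rfl : k = m := by omega
          rw [hsw, if_pos rfl, hF₀ _ hm, hF₀ _ hl, ← hmixed _ hl, hinv _ _ hm]
      have h₁ := ih l (by omega) k m hk (by omega) hm (by omega)
      have hc : r m * r l = r l * r m := by
        rcases Nat.lt_or_ge m l with h | h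
        · exact hcomm m l (by omega) hl
        · exact (hcomm l m (by omega) hm).symm
      have h₂ : Equiv.swap m (m + 1) (l + 1) = l + 1 := by
        rw [hsw, if_neg (by omega), if_neg (by omega)]
      have h₃ : Equiv.swap m (m + 1) l = l := by
        rw [hsw, if_neg (by omega), if_neg (by omega)]
      rw [h₃] at h₁
      have h₄ : Equiv.swap m (m + 1) k < l := by
        rw [hsw]; split_ifs <;> omega
      rw [h₂, hF₁ _ l h₄ hl, ← h₁]
      calc _ = (r m * r l) * F k l * (r l * r m) := by simp only [mul_assoc]
        _ = _ := by rw [← hc]; nth_rw 1 [hc]; simp only [mul_assoc]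
    · obtain rfl : k = l := by omega
      have hkm : k ≠ m := by omega
      by_cases hm₁ : m + 1 = k
      · subst hm₁
        rw [hsw, hsw, if_neg (by omega), if_pos rfl, if_neg (by omega), if_neg (by omega),
          hF₀ _ hl, hF₁ m (m + 1) (by omega) hl, hF₀ _ hm, hmixed _ hl]
      · rw [hsw, hsw, if_neg (by omega), if_neg (by omega), if_neg (by omega), if_neg (by omega),
          hF₀ _ hl, conj_far m _ hm (hb m k hm hl (by omega))]

/-! ### The elements attached to pairs of strands -/

namespace STVB

variable {n : ℕ}

theorem rho_mul_self (i : Fin (n - 1)) : rho i * rho i = 1 :=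
  PresentedMonoid.mk_eq_mk_of_rel (.rho_sq i)

theorem rho_comm (i j : Fin (n - 1)) (h : CrossFar i j) : rho i * rho j = rho j * rho i :=
  PresentedMonoid.mk_eq_mk_of_rel (.rho_comm i j h)

theorem rho_braid (i j : Fin (n - 1)) (h : (i : ℕ) + 1 = j) :
    rho i * rho j * rho i = rho j * rho i * rho j :=
  PresentedMonoid.mk_eq_mk_of_rel (.rho_braid i j h)

theorem sigma_mul_sigmaInv (i : Fin (n - 1)) : sigma i * sigmaInv i = 1 :=
  PresentedMonoid.mk_eq_mk_of_rel (.sigma_mul_inv i)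

theorem sigmaInv_mul_sigma (i : Fin (n - 1)) : sigmaInv i * sigma i = 1 :=
  PresentedMonoid.mk_eq_mk_of_rel (.sigma_inv_mul i)

theorem rho_mul_rho_mul (i : Fin (n - 1)) (w : STVB n) : rho i * (rho i * w) = w := by
  rw [← mul_assoc, rho_mul_self, one_mul]

theorem crossFar_symm {i j : Fin (n - 1)} (h : CrossFar i j) : CrossFar j i := Or.symm h

/-- A family of elements indexed by crossings on which conjugation by the `ρ_i` acts as on the
family `σ_i`. -/
structure IsCrossing (a : Fin (n - 1) → STVB n) : Prop where
  comm : ∀ i j, CrossFar i j → rho i * a j = a j * rho i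
  mixed : ∀ i j : Fin (n - 1), (i : ℕ) + 1 = j → rho i * a j * rho i = rho j * a i * rho j

theorem isCrossing_sigma : IsCrossing (sigma (n := n)) where
  comm i j h := (PresentedMonoid.mk_eq_mk_of_rel (.sigma_rho_comm j i (crossFar_symm h))).symm
  mixed i j h := PresentedMonoid.mk_eq_mk_of_rel (.rho_sigma_rho i j h)

theorem isCrossing_tau : IsCrossing (tau (n := n)) where
  comm i j h := (PresentedMonoid.mk_eq_mk_of_rel (.tau_rho_comm j i (crossFar_symm h))).symm
  mixed i j h := PresentedMonoid.mk_eq_mk_of_rel (.rho_tau_rho i j h)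

/-- The defining relations do not mix `σ_i⁻¹` with `ρ_j`; these identities follow from those for
`σ_i` by uniqueness of inverses. -/
theorem isCrossing_sigmaInv : IsCrossing (sigmaInv (n := n)) where
  comm i j h := by
    have h₁ := isCrossing_sigma.comm i j h
    calc rho i * sigmaInv j = sigmaInv j * (sigma j * rho i) * sigmaInv j := by
          rw [← mul_assoc, sigmaInv_mul_sigma, one_mul]
      _ = sigmaInv j * rho i := by
          rw [← h₁, mul_assoc, mul_assoc, sigma_mul_sigmaInv, mul_one]
  mixed i j h := by
    have h₁ := isCrossing_sigma.mixed i j h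
    refine left_inv_eq_right_inv (a := rho i * sigma j * rho i) ?_ ?_
    · simp only [mul_assoc, rho_mul_rho_mul]
      rw [← mul_assoc (sigmaInv j), sigmaInv_mul_sigma, one_mul, rho_mul_self]
    · rw [h₁]
      simp only [mul_assoc, rho_mul_rho_mul]
      rw [← mul_assoc (sigma i), sigma_mul_sigmaInv, one_mul, rho_mul_self]

/-- For `k > l` the element `a_{k,l}` is built from `ρ_l a_l ρ_l` exactly as `a_{l,k}` is built from
`a_l`. Hence results for increasing pairs carry over to decreasing ones. -/
theorem IsCrossing.conj {a : Fin (n - 1) → STVB n} (ha : IsCrossing a) :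
    IsCrossing fun i => rho i * a i * rho i where
  comm i j h := by
    have h₁ := rho_comm i j h
    calc rho i * (rho j * a j * rho j) = (rho i * rho j) * a j * rho j := by
          simp only [mul_assoc]
      _ = rho j * (rho i * a j) * rho j := by rw [h₁]; simp only [mul_assoc]
      _ = rho j * a j * (rho i * rho j) := by rw [ha.comm i j h]; simp only [mul_assoc]
      _ = _ := by rw [h₁]; simp only [mul_assoc]
  mixed i j h := by
    have h₁ := ha.mixed i j h
    have h₂ : a j = rho i * (rho j * a i * rho j) * rho i := by
      rw [← h₁]
      simp only [mul_assoc, rho_mul_self, mul_one, rho_mul_rho_mul]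
    have h₃ := rho_braid i j h
    have h₄ : rho i * rho j * rho i * rho j = rho j * rho i := by
      rw [h₃, mul_assoc, rho_mul_self, mul_one]
    have h₅ : rho j * rho i * rho j * rho i = rho i * rho j := by
      rw [← h₃, mul_assoc, rho_mul_self, mul_one]
    calc rho i * (rho j * a j * rho j) * rho i
        = (rho i * rho j * rho i * rho j) * a i * (rho j * rho i * rho j * rho i) := by
          rw [h₂]; simp only [mul_assoc]
      _ = _ := by rw [h₄, h₅]; simp only [mul_assoc]

theorem crossLo_lt_crossHi (i : Fin (n - 1)) : crossLo i < crossHi i := by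
  simp [crossLo, crossHi]

theorem crossLo_ne_crossHi (i : Fin (n - 1)) : crossLo i ≠ crossHi i := (crossLo_lt_crossHi i).ne

theorem rhoList_cross (m : Fin (n - 1)) : rhoList (crossLo m) (crossHi m) = [] := by
  simp [rhoList, crossLo, crossHi]

theorem rhoList_crossHi (k : Fin n) (m : Fin (n - 1)) (h : k < crossLo m) :
    rhoList k (crossHi m) = rhoList k (crossLo m) ++ [rho m] := by
  obtain ⟨k, hk⟩ := k
  obtain ⟨m, hm⟩ := m
  simp only [crossLo, Fin.mk_lt_mk] at h
  obtain ⟨d, rfl⟩ : ∃ d, m = k + 1 + d := ⟨m - (k + 1), by omega⟩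
  simp only [rhoList, crossHi, crossLo]
  rw [List.ofFn_congr (show k + 1 + d + 1 - k - 1 = d + 1 by omega), List.ofFn_succ_last,
    List.ofFn_congr (show k + 1 + d - k - 1 = d by omega)]
  rfl

theorem strandPair_cross (a : Fin (n - 1) → STVB n) (m : Fin (n - 1)) :
    strandPair a (crossLo m) (crossHi m) (crossLo_ne_crossHi m) = a m := by
  rw [strandPair, dif_pos (crossLo_lt_crossHi m), rhoList_cross]
  simp [crossLo]

theorem strandPair_cross' (a : Fin (n - 1) → STVB n) (m : Fin (n - 1)) :
    strandPair a (crossHi m) (crossLo m) (crossLo_ne_crossHi m).symm = rho m * a m * rho m := by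
  rw [strandPair, dif_neg (crossLo_lt_crossHi m).not_gt, rhoList_cross]
  simp [crossLo]

theorem strandPair_crossHi (a : Fin (n - 1) → STVB n) (k : Fin n) (m : Fin (n - 1))
    (h : k < crossLo m) :
    strandPair a k (crossHi m) (h.trans (crossLo_lt_crossHi m)).ne =
      rho m * strandPair a k (crossLo m) h.ne * rho m := by
  rw [strandPair, strandPair, dif_pos h, dif_pos (h.trans (crossLo_lt_crossHi m)),
    rhoList_crossHi k m h]
  simp [mul_assoc]

theorem strandPair_crossHi' (a : Fin (n - 1) → STVB n) (k : Fin n) (m : Fin (n - 1))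
    (h : k < crossLo m) :
    strandPair a (crossHi m) k (h.trans (crossLo_lt_crossHi m)).ne' =
      rho m * strandPair a (crossLo m) k h.ne' * rho m := by
  rw [strandPair, strandPair, dif_neg h.not_gt, dif_neg (h.trans (crossLo_lt_crossHi m)).not_gt,
    rhoList_crossHi k m h]
  simp [mul_assoc]

/-- Induction on pairs of different strands. -/
theorem pair_induction {P : ∀ k l : Fin n, k ≠ l → Prop}
    (h₀ : ∀ m, P (crossLo m) (crossHi m) (crossLo_ne_crossHi m))
    (h₀' : ∀ m, P (crossHi m) (crossLo m) (crossLo_ne_crossHi m).symm)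
    (h₁ : ∀ k m (h : k < crossLo m), P k (crossLo m) h.ne →
      P k (crossHi m) (h.trans (crossLo_lt_crossHi m)).ne)
    (h₁' : ∀ k m (h : k < crossLo m), P (crossLo m) k h.ne' →
      P (crossHi m) k (h.trans (crossLo_lt_crossHi m)).ne')
    (k l : Fin n) (h : k ≠ l) : P k l h := by
  have key : ∀ d : ℕ, ∀ k l : Fin n, ∀ h : k < l, (l : ℕ) = d → P k l h.ne ∧ P l k h.ne' := by
    intro d
    induction d with
    | zero => intro k l h hl; simp only [Fin.lt_def] at h; omega
    | succ d ih =>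
      intro k l h hl
      have hd : d < n - 1 := by omega
      obtain rfl : l = crossHi ⟨d, hd⟩ := Fin.ext hl
      by_cases hk : k = crossLo ⟨d, hd⟩
      · subst hk
        exact ⟨h₀ _, h₀' _⟩
      · have hk' : k < crossLo ⟨d, hd⟩ := by
          simp only [Fin.lt_def, Fin.ext_iff, crossLo, crossHi] at h hk ⊢
          omega
        have := ih k (crossLo ⟨d, hd⟩) hk' rfl
        exact ⟨h₁ _ _ hk' this.1, h₁' _ _ hk' this.2⟩
  rcases lt_or_gt_of_ne h with h | h
  · exact (key _ k l h rfl).1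
  · exact (key _ l k h rfl).2

/-- A function on `Fin n × Fin n` extended to `ℕ × ℕ` by `1`. -/
def extendOne (F : ∀ k l : Fin n, k ≠ l → STVB n) (k l : ℕ) : STVB n :=
  if h : ∃ (hk : k < n) (hl : l < n), k ≠ l then
    F ⟨k, h.1⟩ ⟨l, h.2.1⟩ (by obtain ⟨_, _, h⟩ := h; simpa using h) else 1

theorem extendOne_val (F : ∀ k l : Fin n, k ≠ l → STVB n) {k l : Fin n} (h : k ≠ l) :
    extendOne F k l = F k l h :=
  dif_pos ⟨k.2, l.2, fun e => h (Fin.ext e)⟩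

theorem val_swap_cross (m : Fin (n - 1)) (k : Fin n) :
    ((Equiv.swap (crossLo m) (crossHi m) k : Fin n) : ℕ) = Equiv.swap (m : ℕ) (m + 1) k := by
  simp only [Equiv.swap_apply_def, Fin.ext_iff, crossLo, crossHi]
  split_ifs <;> rfl

/-- This is `conj_eq_swap` with all indices extended to `ℕ` by the junk value `1`. The family `F` is
left general so that it can be `a_{k,l}` or, with `a` conjugated, `a_{l,k}`. -/
theorem conj_rho_of_lt {a : Fin (n - 1) → STVB n} (ha : IsCrossing a)
    {F : ∀ k l : Fin n, k ≠ l → STVB n}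
    (h₀ : ∀ m, F (crossLo m) (crossHi m) (crossLo_ne_crossHi m) = a m)
    (h₁ : ∀ k m (h : k < crossLo m), F k (crossHi m) (h.trans (crossLo_lt_crossHi m)).ne =
      rho m * F k (crossLo m) h.ne * rho m)
    {k l : Fin n} (hkl : k < l) (m : Fin (n - 1)) (hne : ¬ (k = crossLo m ∧ l = crossHi m)) :
    rho m * F k l hkl.ne * rho m = F (Equiv.swap (crossLo m) (crossHi m) k)
      (Equiv.swap (crossLo m) (crossHi m) l) ((Equiv.injective _).ne hkl.ne) := by
  let r : ℕ → STVB n := fun i => if h : i < n - 1 then rho ⟨i, h⟩ else 1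
  let b : ℕ → STVB n := fun i => if h : i < n - 1 then a ⟨i, h⟩ else 1
  have hr : ∀ i (h : i < n - 1), r i = rho ⟨i, h⟩ := fun i h => dif_pos h
  have hb : ∀ i (h : i < n - 1), b i = a ⟨i, h⟩ := fun i h => dif_pos h
  have := conj_eq_swap (N := n - 1) (r := r) (b := b) (F := extendOne F) ?_ ?_ ?_ ?_ ?_ ?_ ?_
    l k m hkl (by omega) m.2 ?_
  · rwa [hr m m.2, extendOne_val F hkl.ne, ← val_swap_cross, ← val_swap_cross,
      extendOne_val] at this
  · intro i hi
    rw [hr i hi, rho_mul_self]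
  · intro i j hij hj
    rw [hr i (by omega), hr j hj, rho_comm _ _ (Or.inl hij)]
  · intro i hi
    rw [hr i (by omega), hr _ hi, rho_braid _ _ rfl]
  · intro i j hi hj hij
    rw [hr i hi, hb j hj, ha.comm ⟨i, hi⟩ ⟨j, hj⟩ hij]
  · intro i hi
    rw [hr i (by omega), hr _ hi, hb i (by omega), hb _ hi, ha.mixed _ _ rfl]
  · intro k hk
    rw [hb k hk, ← h₀, ← extendOne_val F]
    rfl
  · intro k l hkl hl
    rw [hr l hl]
    have hkl' : (⟨k, by omega⟩ : Fin n) < crossLo ⟨l, hl⟩ := hkl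
    have e₁ := extendOne_val F hkl'.ne
    have e₂ := extendOne_val F (hkl'.trans (crossLo_lt_crossHi _)).ne
    rw [h₁ _ _ hkl', ← e₁] at e₂
    exact e₂
  · intro h
    exact hne ⟨Fin.ext h.1, Fin.ext h.2⟩

/-- Conjugation by `ρ_m` permutes the indices of the elements `a_{k,l}`. -/
theorem IsCrossing.conj_rho {a : Fin (n - 1) → STVB n} (ha : IsCrossing a)
    {k l : Fin n} (hkl : k ≠ l) (m : Fin (n - 1)) :
    rho m * strandPair a k l hkl * rho m = strandPair a (Equiv.swap (crossLo m) (crossHi m) k)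
      (Equiv.swap (crossLo m) (crossHi m) l) ((Equiv.injective _).ne hkl) := by
  have hinv : ∀ w : STVB n, rho m * (rho m * w * rho m) * rho m = w := by
    intro w
    simp only [mul_assoc, rho_mul_self, mul_one, rho_mul_rho_mul]
  by_cases h₁ : k = crossLo m ∧ l = crossHi m
  · obtain ⟨rfl, rfl⟩ := h₁
    simp only [Equiv.swap_apply_left, Equiv.swap_apply_right, strandPair_cross, strandPair_cross']
  by_cases h₂ : l = crossLo m ∧ k = crossHi m
  · obtain ⟨rfl, rfl⟩ := h₂
    simp only [Equiv.swap_apply_left, Equiv.swap_apply_right, strandPair_cross, strandPair_cross',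
      hinv]
  rcases lt_or_gt_of_ne hkl with h | h
  · exact conj_rho_of_lt ha (strandPair_cross a) (strandPair_crossHi a) h m h₁
  · exact conj_rho_of_lt (F := fun k l h => strandPair a l k h.symm) ha.conj (strandPair_cross' a)
      (strandPair_crossHi' a) h m h₂

theorem conj_rho_gamma (m : Fin (n - 1)) (j : Fin n) :
    rho m * gamma j * rho m = gamma (Equiv.swap (crossLo m) (crossHi m) j) := by
  have h₀ : gamma (crossHi m) * rho m = rho m * gamma (crossLo m) :=
    PresentedMonoid.mk_eq_mk_of_rel (.gamma_rho m)
  by_cases h₁ : j = crossLo m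
  · subst h₁
    rw [Equiv.swap_apply_left, ← h₀, mul_assoc, rho_mul_self, mul_one]
  by_cases h₂ : j = crossHi m
  · subst h₂
    rw [Equiv.swap_apply_right, mul_assoc, h₀, rho_mul_rho_mul]
  · have h₃ : gamma j * rho m = rho m * gamma j :=
      PresentedMonoid.mk_eq_mk_of_rel (.gamma_rho_comm m j h₁ h₂)
    rw [Equiv.swap_apply_of_ne_of_ne h₁ h₂, ← h₃, mul_assoc, rho_mul_self, mul_one]

end STVB

/-! ### Relabelling strands and the map from the presented monoid -/

namespace STVB

variable {n : ℕ}

/-- Conjugation by `ρ_m`. -/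
def conjRho (m : Fin (n - 1)) : STVB n →* STVB n where
  toFun w := rho m * w * rho m
  map_one' := by rw [mul_one, rho_mul_self]
  map_mul' v w := by simp only [mul_assoc, rho_mul_rho_mul]

theorem closure_swap_cross (n : ℕ) : Submonoid.closure
    (Set.range fun m : Fin (n - 1) => Equiv.swap (crossLo m) (crossHi m)) = ⊤ := by
  cases n with
  | zero => exact Subsingleton.elim _ _
  | succ n => exact Equiv.Perm.mclosure_swap_castSucc_succ n

/-- Every permutation of the strands is induced by an endomorphism of `STVB n`. -/
theorem exists_end (π : Equiv.Perm (Fin n)) : ∃ c : STVB n →* STVB n,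
    (∀ a, IsCrossing a → ∀ k l (h : k ≠ l),
      c (strandPair a k l h) = strandPair a (π k) (π l) (π.injective.ne h)) ∧
    ∀ j, c (gamma j) = gamma (π j) := by
  have hπ : π ∈ Submonoid.closure
      (Set.range fun m : Fin (n - 1) => Equiv.swap (crossLo m) (crossHi m)) := by
    rw [closure_swap_cross]; trivial
  induction hπ using Submonoid.closure_induction with
  | mem π hπ =>
    obtain ⟨m, rfl⟩ := hπ
    exact ⟨conjRho m, fun a ha k l h => ha.conj_rho h m, conj_rho_gamma m⟩
  | one => exact ⟨MonoidHom.id _, fun _ _ _ _ _ => rfl, fun _ => rfl⟩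
  | mul π ψ _ _ h₁ h₂ =>
    obtain ⟨c, hc, hc'⟩ := h₁
    obtain ⟨d, hd, hd'⟩ := h₂
    refine ⟨c.comp d, fun a ha k l h => ?_, fun j => ?_⟩
    · rw [MonoidHom.comp_apply, hd a ha, hc a ha]; rfl
    · rw [MonoidHom.comp_apply, hd', hc']; rfl

/-- The symmetric group is multiply transitive, so any distinct strands can be taken to be the first
ones. -/
theorem exists_perm_castLE {m : ℕ} {q : Fin m → Fin n} (hq : Function.Injective q) :
    ∃ (h : m ≤ n) (π : Equiv.Perm (Fin n)), ∀ i, π (Fin.castLE h i) = q i := by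
  have h : m ≤ n := by simpa using Fintype.card_le_of_injective q hq
  have := Equiv.Perm.isMultiplyPretransitive (Fin n) m
  obtain ⟨π, hπ⟩ := MulAction.exists_smul_eq (Equiv.Perm (Fin n)) (Fin.castLEEmb h) ⟨q, hq⟩
  exact ⟨h, π, fun i => DFunLike.congr_fun hπ i⟩

/-- This lemma and the next two reduce a relation on two, three or four distinct strands to the
crossings `0`, to `0` and `1`, or to `0` and `2`, where the defining relations apply. -/
theorem exists_end_pair {i j : Fin n} (hij : i ≠ j) :
    ∃ (m : Fin (n - 1)) (c : STVB n →* STVB n),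
      (∀ a, IsCrossing a → c (a m) = strandPair a i j hij) ∧
      (∀ a, IsCrossing a → c (rho m * a m * rho m) = strandPair a j i hij.symm) ∧
      c (gamma (crossLo m)) = gamma i ∧ c (gamma (crossHi m)) = gamma j := by
  obtain ⟨h, π, hπ⟩ := exists_perm_castLE (q := ![i, j]) (by
    intro a b; fin_cases a <;> fin_cases b <;> simp [hij, hij.symm])
  obtain ⟨c, hc, hc'⟩ := exists_end π
  let m : Fin (n - 1) := ⟨0, by omega⟩
  have h₀ : π (crossLo m) = i := hπ 0
  have h₁ : π (crossHi m) = j := hπ 1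
  refine ⟨m, c, fun a ha => ?_, fun a ha => ?_, by rw [hc', h₀], by rw [hc', h₁]⟩
  · rw [← strandPair_cross a m, hc a ha]; simp only [h₀, h₁]
  · rw [← strandPair_cross' a m, hc a ha]; simp only [h₀, h₁]

theorem exists_end_triple {i j k : Fin n} (hij : i ≠ j) (hik : i ≠ k) (hjk : j ≠ k) :
    ∃ (m m' : Fin (n - 1)) (_ : (m : ℕ) + 1 = m') (c : STVB n →* STVB n),
      (∀ a, IsCrossing a → c (a m) = strandPair a i j hij) ∧
      (∀ a, IsCrossing a → c (a m') = strandPair a j k hjk) ∧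
      c (gamma (crossHi m')) = gamma k := by
  obtain ⟨h, π, hπ⟩ := exists_perm_castLE (q := ![i, j, k]) (by
    intro a b
    fin_cases a <;> fin_cases b <;> simp [hij, hij.symm, hik, hik.symm, hjk, hjk.symm])
  obtain ⟨c, hc, hc'⟩ := exists_end π
  let m : Fin (n - 1) := ⟨0, by omega⟩
  let m' : Fin (n - 1) := ⟨1, by omega⟩
  have h₀ : π (crossLo m) = i := hπ 0
  have h₁ : π (crossHi m) = j := hπ 1
  have h₁' : π (crossLo m') = j := hπ 1
  have h₂ : π (crossHi m') = k := hπ 2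
  refine ⟨m, m', rfl, c, fun a ha => ?_, fun a ha => ?_, by rw [hc', h₂]⟩
  · rw [← strandPair_cross a m, hc a ha]; simp only [h₀, h₁]
  · rw [← strandPair_cross a m', hc a ha]; simp only [h₁', h₂]

theorem exists_end_quadruple {i j k l : Fin n} (hij : i ≠ j) (hkl : k ≠ l)
    (hik : i ≠ k) (hil : i ≠ l) (hjk : j ≠ k) (hjl : j ≠ l) :
    ∃ (m m' : Fin (n - 1)) (_ : CrossFar m m') (c : STVB n →* STVB n),
      (∀ a, IsCrossing a → c (a m) = strandPair a i j hij) ∧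
      (∀ a, IsCrossing a → c (a m') = strandPair a k l hkl) := by
  obtain ⟨h, π, hπ⟩ := exists_perm_castLE (q := ![i, j, k, l]) (by
    intro a b
    fin_cases a <;> fin_cases b <;> simp [hij, hij.symm, hik, hik.symm, hjk, hjk.symm, hkl,
      hkl.symm, hil, hil.symm, hjl, hjl.symm])
  obtain ⟨c, hc, hc'⟩ := exists_end π
  let m : Fin (n - 1) := ⟨0, by omega⟩
  let m' : Fin (n - 1) := ⟨2, by omega⟩
  have h₀ : π (crossLo m) = i := hπ 0
  have h₁ : π (crossHi m) = j := hπ 1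
  have h₂ : π (crossLo m') = k := hπ 2
  have h₃ : π (crossHi m') = l := hπ 3
  refine ⟨m, m', Or.inl (by simp [m, m']), c, fun a ha => ?_, fun a ha => ?_⟩
  · rw [← strandPair_cross a m, hc a ha]; simp only [h₀, h₁]
  · rw [← strandPair_cross a m', hc a ha]; simp only [h₂, h₃]

/-- Apart from those in the `γ_j` alone, each relation is the image, under an index-permuting
endomorphism, of an identity between standard generators. -/
theorem toSTVB_rel (a b : FreeMonoid (STVHGen n)) (h : STVHRel n a b) :
    FreeMonoid.lift STVHGen.toSTVB a = FreeMonoid.lift STVHGen.toSTVB b := by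
  have hs := isCrossing_sigma (n := n)
  have hs' := isCrossing_sigmaInv (n := n)
  have ht := isCrossing_tau (n := n)
  cases h <;>
    simp only [map_mul, map_one, FreeMonoid.lift_eval_of, STVHGen.toSTVB, x, xInv, z]
  case gamma_sq i => exact PresentedMonoid.mk_eq_mk_of_rel (.gamma_sq i)
  case gamma_comm i j => exact PresentedMonoid.mk_eq_mk_of_rel (.gamma_comm i j)
  case x_mul_inv i j hij =>
    obtain ⟨m, c, hc, -⟩ := exists_end_pair hij
    rw [← hc _ hs, ← hc _ hs', ← map_mul, sigma_mul_sigmaInv, map_one]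
  case x_inv_mul i j hij =>
    obtain ⟨m, c, hc, -⟩ := exists_end_pair hij
    rw [← hc _ hs, ← hc _ hs', ← map_mul, sigmaInv_mul_sigma, map_one]
  case x_x_comm i j k l hij hkl hik hil hjk hjl =>
    obtain ⟨m, m', hm, c, hc, hc'⟩ := exists_end_quadruple hij hkl hik hil hjk hjl
    rw [← hc _ hs, ← hc' _ hs, ← map_mul, ← map_mul]
    exact congrArg c (PresentedMonoid.mk_eq_mk_of_rel (.sigma_comm m m' hm))
  case x_braid i j k hij hik hkj =>
    obtain ⟨m, m', hm, c, hc, hc', -⟩ := exists_end_triple hik hij hkj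
    simp only [← hc _ hs, ← hc' _ hs, ← map_mul]
    exact congrArg c (PresentedMonoid.mk_eq_mk_of_rel (.sigma_braid m m' hm))
  case x_gamma_comm i j k hij hik hjk =>
    obtain ⟨m, m', hm, c, hc, -, hg⟩ := exists_end_triple hij hik hjk
    rw [← hc _ hs, ← hg, ← map_mul, ← map_mul]
    refine congrArg c (PresentedMonoid.mk_eq_mk_of_rel (.sigma_gamma_comm m _ ?_ ?_)) <;>
      simp only [crossLo, crossHi, ne_eq, Fin.ext_iff] <;> omega
  case x_twist i j hij =>
    -- The pair is reversed so that `ρ σ ρ`, the left side of the defining relation, goes to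
    -- `x_{ij}`, and `σ` goes to `x_{ji}`.
    obtain ⟨m, c, hc, hc', hg, hg'⟩ := exists_end_pair hij.symm
    simp only [← hc' _ hs, ← hc _ hs, ← hg, ← hg', ← map_mul]
    exact congrArg c (PresentedMonoid.mk_eq_mk_of_rel (.rho_sigma_twist m))
  case x_z_comm i j k l hij hkl hik hil hjk hjl =>
    obtain ⟨m, m', hm, c, hc, hc'⟩ := exists_end_quadruple hij hkl hik hil hjk hjl
    rw [← hc _ hs, ← hc' _ ht, ← map_mul, ← map_mul]
    exact congrArg c (PresentedMonoid.mk_eq_mk_of_rel (.sigma_tau_comm m m' hm))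
  case x_x_z i j k hij hik hkj =>
    obtain ⟨m, m', hm, c, hc, hc', -⟩ := exists_end_triple hik hij hkj
    simp only [← hc _ hs, ← hc' _ hs, ← hc _ ht, ← hc' _ ht, ← map_mul]
    exact congrArg c (PresentedMonoid.mk_eq_mk_of_rel (.sigma_sigma_tau m m' hm))
  case z_x_x i j k hij hik hkj =>
    obtain ⟨m, m', hm, c, hc, hc', -⟩ := exists_end_triple hik hij hkj
    simp only [← hc _ hs, ← hc' _ hs, ← hc _ ht, ← hc' _ ht, ← map_mul]
    exact congrArg c (PresentedMonoid.mk_eq_mk_of_rel (.sigma_sigma_tau' m m' hm)).symm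
  case x_z i j hij =>
    obtain ⟨m, c, hc, -⟩ := exists_end_pair hij
    rw [← hc _ hs, ← hc _ ht, ← map_mul, ← map_mul]
    exact congrArg c (PresentedMonoid.mk_eq_mk_of_rel (.sigma_tau m))
  case z_z_comm i j k l hij hkl hik hil hjk hjl =>
    obtain ⟨m, m', hm, c, hc, hc'⟩ := exists_end_quadruple hij hkl hik hil hjk hjl
    rw [← hc _ ht, ← hc' _ ht, ← map_mul, ← map_mul]
    exact congrArg c (PresentedMonoid.mk_eq_mk_of_rel (.tau_comm m m' hm))
  case z_gamma_comm i j k hij hik hjk =>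
    obtain ⟨m, m', hm, c, hc, -, hg⟩ := exists_end_triple hij hik hjk
    rw [← hc _ ht, ← hg, ← map_mul, ← map_mul]
    refine congrArg c (PresentedMonoid.mk_eq_mk_of_rel (.tau_gamma_comm m _ ?_ ?_)) <;>
      simp only [crossLo, crossHi, ne_eq, Fin.ext_iff] <;> omega
  case z_twist i j hij =>
    obtain ⟨m, c, hc, hc', hg, hg'⟩ := exists_end_pair hij.symm
    simp only [← hc' _ ht, ← hc _ ht, ← hg, ← hg', ← map_mul]
    exact congrArg c (PresentedMonoid.mk_eq_mk_of_rel (.rho_tau_twist m))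

/-- The homomorphism from the presented monoid to `STVB n`. -/
def ofPresented (n : ℕ) : PresentedMonoid (STVHRel n) →* STVB n :=
  PresentedMonoid.lift STVHGen.toSTVB toSTVB_rel

end STVB

namespace STVHGen

variable {n : ℕ}

/-- The action of permutations of the strands on the generating symbols. -/
def perm (π : Equiv.Perm (Fin n)) : STVHGen n → STVHGen n
  | x k l h => x (π k) (π l) (π.injective.ne h)
  | xInv k l h => xInv (π k) (π l) (π.injective.ne h)
  | z k l h => z (π k) (π l) (π.injective.ne h)
  | gamma j => gamma (π j)

end STVHGen

/-! ### The action on the presented monoid, and injectivity -/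

namespace STVH

variable {n : ℕ}

/-- The presented monoid. -/
local notation "H" => PresentedMonoid (STVHRel n)

/-- The side conditions only require indices to differ, and `π` is injective, so the set of
relations is stable under relabelling. -/
theorem perm_rel (π : Equiv.Perm (Fin n)) (a b : FreeMonoid (STVHGen n)) (h : STVHRel n a b) :
    FreeMonoid.lift (fun s => PresentedMonoid.of (STVHRel n) (s.perm π)) a =
      FreeMonoid.lift (fun s => PresentedMonoid.of (STVHRel n) (s.perm π)) b := by
  have hn : ∀ {i j : Fin n}, i ≠ j → π i ≠ π j := fun h => π.injective.ne h
  have hrel : ∀ {a b : FreeMonoid (STVHGen n)}, STVHRel n a b →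
    PresentedMonoid.mk (STVHRel n) a = PresentedMonoid.mk (STVHRel n) b :=
      fun h => PresentedMonoid.mk_eq_mk_of_rel h
  cases h <;> simp only [map_mul, map_one, FreeMonoid.lift_eval_of, STVHGen.perm]
  case gamma_sq i => exact hrel (.gamma_sq _)
  case gamma_comm i j => exact hrel (.gamma_comm _ _)
  case x_mul_inv i j hij => exact hrel (.x_mul_inv _ _ _)
  case x_inv_mul i j hij => exact hrel (.x_inv_mul _ _ _)
  case x_x_comm i j k l hij hkl hik hil hjk hjl =>
    exact hrel (.x_x_comm _ _ _ _ _ _ (hn hik) (hn hil) (hn hjk) (hn hjl))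
  case x_braid i j k hij hik hkj => exact hrel (.x_braid _ _ _ (hn hij) _ _)
  case x_gamma_comm i j k hij hik hjk => exact hrel (.x_gamma_comm _ _ _ _ (hn hik) (hn hjk))
  case x_twist i j hij => exact hrel (.x_twist _ _ _)
  case x_z_comm i j k l hij hkl hik hil hjk hjl =>
    exact hrel (.x_z_comm _ _ _ _ _ _ (hn hik) (hn hil) (hn hjk) (hn hjl))
  case x_x_z i j k hij hik hkj => exact hrel (.x_x_z _ _ _ (hn hij) _ _)
  case z_x_x i j k hij hik hkj => exact hrel (.z_x_x _ _ _ (hn hij) _ _)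
  case x_z i j hij => exact hrel (.x_z _ _ _)
  case z_z_comm i j k l hij hkl hik hil hjk hjl =>
    exact hrel (.z_z_comm _ _ _ _ _ _ (hn hik) (hn hil) (hn hjk) (hn hjl))
  case z_gamma_comm i j k hij hik hjk => exact hrel (.z_gamma_comm _ _ _ _ (hn hik) (hn hjk))
  case z_twist i j hij => exact hrel (.z_twist _ _ _)

/-- The endomorphism of the presented monoid induced by a permutation of the strands. -/
def perm (π : Equiv.Perm (Fin n)) : H →* H :=
  PresentedMonoid.lift (fun s => PresentedMonoid.of _ (s.perm π)) (perm_rel π)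

theorem perm_of (π : Equiv.Perm (Fin n)) (s : STVHGen n) :
    perm π (PresentedMonoid.of _ s) = PresentedMonoid.of _ (s.perm π) := rfl

theorem perm_one : perm (1 : Equiv.Perm (Fin n)) = MonoidHom.id H := by
  ext s
  cases s <;> rfl

theorem perm_mul (π ψ : Equiv.Perm (Fin n)) : perm (π * ψ) = (perm π).comp (perm ψ) := by
  ext s
  cases s <;> rfl

/-- The action of permutations of the strands on the presented monoid. -/
def permEnd (n : ℕ) : Equiv.Perm (Fin n) →* Function.End (PresentedMonoid (STVHRel n)) where
  toFun π := fun h => perm π h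
  map_one' := by rw [perm_one]; rfl
  map_mul' π ψ := by rw [perm_mul]; rfl

/-- Left multiplication on the presented monoid. -/
def mulLeft (n : ℕ) : PresentedMonoid (STVHRel n) →*
    Function.End (PresentedMonoid (STVHRel n)) := MulAction.toEndHom

/-- The commutation rule of the semidirect product, realised by self-maps of `H`. -/
theorem permEnd_mul_mulLeft (π : Equiv.Perm (Fin n)) (h : H) :
    permEnd n π * mulLeft n h = mulLeft n (perm π h) * permEnd n π :=
  funext fun h' => map_mul (perm π) h h'

theorem swap_mul_mulLeft_mul_swap (a b : Fin n) (h : H) :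
    permEnd n (Equiv.swap a b) * mulLeft n h * permEnd n (Equiv.swap a b) =
      mulLeft n (perm (Equiv.swap a b) h) := by
  rw [permEnd_mul_mulLeft, mul_assoc, ← map_mul, Equiv.swap_mul_self, map_one, mul_one]

/-- The values on generators of the action of `STVB n` on the presented monoid in which `ρ_i` acts
by permuting indices and the other generators act by left multiplication. -/
def actGen : STVBGen n → Function.End H
  | .sigma i => mulLeft n (PresentedMonoid.of _ (.x _ _ (STVB.crossLo_ne_crossHi i)))
  | .sigmaInv i => mulLeft n (PresentedMonoid.of _ (.xInv _ _ (STVB.crossLo_ne_crossHi i)))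
  | .rho i => permEnd n (Equiv.swap (crossLo i) (crossHi i))
  | .tau i => mulLeft n (PresentedMonoid.of _ (.z _ _ (STVB.crossLo_ne_crossHi i)))
  | .gamma j => mulLeft n (PresentedMonoid.of _ (.gamma j))

theorem crossFar_ne {i j : Fin (n - 1)} (h : CrossFar i j) : crossLo i ≠ crossLo j ∧
    crossLo i ≠ crossHi j ∧ crossHi i ≠ crossLo j ∧ crossHi i ≠ crossHi j := by
  simp only [CrossFar, crossLo, crossHi, ne_eq, Fin.ext_iff] at *
  omega

theorem crossHi_eq_crossLo {i j : Fin (n - 1)} (h : (i : ℕ) + 1 = j) :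
    crossHi i = crossLo j := Fin.ext h

theorem crossLo_ne_crossHi_of_succ {i j : Fin (n - 1)} (h : (i : ℕ) + 1 = j) :
    crossLo i ≠ crossHi j := by
  simp only [crossLo, crossHi, ne_eq, Fin.ext_iff]
  omega

/-- A family of elements of the presented monoid on which permutations act through the indices. -/
def IsEquivariant (Y : ∀ k l : Fin n, k ≠ l → H) : Prop :=
  ∀ (π : Equiv.Perm (Fin n)) k l (h : k ≠ l), perm π (Y k l h) = Y (π k) (π l) (π.injective.ne h)

theorem IsEquivariant.comm {Y : ∀ k l : Fin n, k ≠ l → H} (hY : IsEquivariant Y)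
    {i j : Fin (n - 1)} (h : CrossFar i j) :
    mulLeft n (Y _ _ (STVB.crossLo_ne_crossHi i)) *
        permEnd n (Equiv.swap (crossLo j) (crossHi j)) =
      permEnd n (Equiv.swap (crossLo j) (crossHi j)) *
        mulLeft n (Y _ _ (STVB.crossLo_ne_crossHi i)) := by
  obtain ⟨h₁, h₂, h₃, h₄⟩ := crossFar_ne h
  rw [permEnd_mul_mulLeft, hY]
  simp only [Equiv.swap_apply_of_ne_of_ne h₁ h₂, Equiv.swap_apply_of_ne_of_ne h₃ h₄]

/-- Both sides are left multiplication by `Y` at the outer strands `crossLo i` and `crossHi j`. -/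
theorem IsEquivariant.mixed {Y : ∀ k l : Fin n, k ≠ l → H} (hY : IsEquivariant Y)
    {i j : Fin (n - 1)} (h : (i : ℕ) + 1 = j) :
    permEnd n (Equiv.swap (crossLo i) (crossHi i)) *
        mulLeft n (Y _ _ (STVB.crossLo_ne_crossHi j)) *
        permEnd n (Equiv.swap (crossLo i) (crossHi i)) =
      permEnd n (Equiv.swap (crossLo j) (crossHi j)) *
        mulLeft n (Y _ _ (STVB.crossLo_ne_crossHi i)) *
        permEnd n (Equiv.swap (crossLo j) (crossHi j)) := by
  have h₁ := crossLo_ne_crossHi_of_succ h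
  have h₂ := STVB.crossLo_ne_crossHi i
  have h₃ := STVB.crossLo_ne_crossHi j
  rw [crossHi_eq_crossLo h] at h₂
  rw [swap_mul_mulLeft_mul_swap, swap_mul_mulLeft_mul_swap, hY, hY]
  simp only [crossHi_eq_crossLo h, Equiv.swap_apply_right, Equiv.swap_apply_left,
    Equiv.swap_apply_of_ne_of_ne h₁.symm h₃.symm, Equiv.swap_apply_of_ne_of_ne h₂ h₁]

theorem isEquivariant_x :
    IsEquivariant fun k l (h : k ≠ l) => PresentedMonoid.of (STVHRel n) (.x k l h) :=
  fun _ _ _ _ => rfl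

theorem isEquivariant_xInv :
    IsEquivariant fun k l (h : k ≠ l) => PresentedMonoid.of (STVHRel n) (.xInv k l h) :=
  fun _ _ _ _ => rfl

theorem isEquivariant_z :
    IsEquivariant fun k l (h : k ≠ l) => PresentedMonoid.of (STVHRel n) (.z k l h) :=
  fun _ _ _ _ => rfl

/-- Relations without `ρ` become relations of `H`, those in `ρ` alone become identities of
permutations, and the mixed ones follow from `permEnd_mul_mulLeft`, together with `x_twist` or
`z_twist` for the two twist relations. -/
theorem actGen_rel (a b : FreeMonoid (STVBGen n)) (h : STVBRel n a b) :
    FreeMonoid.lift actGen a = FreeMonoid.lift actGen b := by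
  have hrel : ∀ {a b : FreeMonoid (STVHGen n)}, STVHRel n a b →
    mulLeft n (PresentedMonoid.mk (STVHRel n) a) = mulLeft n (PresentedMonoid.mk (STVHRel n) b) :=
      fun h => congrArg _ (PresentedMonoid.mk_eq_mk_of_rel h)
  -- For relations in `ρ` alone this is the required identity in the symmetric group, already
  -- checked for `φ₂`.
  have hrho := STVB.phi₂Gen_rel a b h
  cases h <;>
    simp only [map_mul, map_one, FreeMonoid.lift_eval_of, actGen, STVB.phi₂Gen] at hrho ⊢
  case rho_sq i => rw [← map_mul, hrho, map_one]
  case rho_comm i j h => rw [← map_mul, hrho, map_mul]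
  case rho_braid i j h => simp only [← map_mul, hrho]
  case sigma_rho_comm i j h => exact isEquivariant_x.comm h
  case tau_rho_comm i j h => exact isEquivariant_z.comm h
  case rho_sigma_rho i j h => exact isEquivariant_x.mixed h
  case rho_tau_rho i j h => exact isEquivariant_z.mixed h
  case sigma_comm i j h =>
    obtain ⟨h₁, h₂, h₃, h₄⟩ := crossFar_ne h
    simp only [← map_mul]
    exact hrel (.x_x_comm _ _ _ _ _ _ h₁ h₂ h₃ h₄)
  case sigma_tau_comm i j h =>
    obtain ⟨h₁, h₂, h₃, h₄⟩ := crossFar_ne h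
    simp only [← map_mul]
    exact hrel (.x_z_comm _ _ _ _ _ _ h₁ h₂ h₃ h₄)
  case tau_comm i j h =>
    obtain ⟨h₁, h₂, h₃, h₄⟩ := crossFar_ne h
    simp only [← map_mul]
    exact hrel (.z_z_comm _ _ _ _ _ _ h₁ h₂ h₃ h₄)
  case sigma_braid i j h =>
    have h₂ := STVB.crossLo_ne_crossHi i
    simp only [crossHi_eq_crossLo h] at h₂ ⊢
    simp only [← map_mul]
    exact hrel (.x_braid _ _ _ (crossLo_ne_crossHi_of_succ h) h₂ _)
  case sigma_sigma_tau i j h =>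
    have h₂ := STVB.crossLo_ne_crossHi i
    simp only [crossHi_eq_crossLo h] at h₂ ⊢
    simp only [← map_mul]
    exact hrel (.x_x_z _ _ _ (crossLo_ne_crossHi_of_succ h) h₂ _)
  case sigma_sigma_tau' i j h =>
    have h₂ := STVB.crossLo_ne_crossHi i
    simp only [crossHi_eq_crossLo h] at h₂ ⊢
    simp only [← map_mul]
    exact (hrel (.z_x_x _ _ _ (crossLo_ne_crossHi_of_succ h) h₂ _)).symm
  case gamma_sq i =>
    rw [← map_mul]
    exact (hrel (.gamma_sq i)).trans (map_one _)
  case gamma_comm i j =>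
    simp only [← map_mul]
    exact hrel (.gamma_comm i j)
  case gamma_rho_comm i j h₁ h₂ =>
    rw [permEnd_mul_mulLeft, perm_of, STVHGen.perm, Equiv.swap_apply_of_ne_of_ne h₁ h₂]
  case gamma_rho i =>
    rw [permEnd_mul_mulLeft, perm_of, STVHGen.perm, Equiv.swap_apply_left]
  case sigma_gamma_comm i j h₁ h₂ =>
    simp only [← map_mul]
    exact hrel (.x_gamma_comm _ _ _ _ h₁.symm h₂.symm)
  case tau_gamma_comm i j h₁ h₂ =>
    simp only [← map_mul]
    exact hrel (.z_gamma_comm _ _ _ _ h₁.symm h₂.symm)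
  case sigma_mul_inv i =>
    rw [← map_mul]
    exact (hrel (.x_mul_inv _ _ _)).trans (map_one _)
  case sigma_inv_mul i =>
    rw [← map_mul]
    exact (hrel (.x_inv_mul _ _ _)).trans (map_one _)
  case sigma_tau i =>
    simp only [← map_mul]
    exact hrel (.x_z _ _ _)
  case rho_sigma_twist i =>
    rw [swap_mul_mulLeft_mul_swap, perm_of, STVHGen.perm]
    simp only [Equiv.swap_apply_left, Equiv.swap_apply_right]
    simp only [← map_mul]
    exact hrel (.x_twist _ _ _)
  case rho_tau_twist i =>
    rw [swap_mul_mulLeft_mul_swap, perm_of, STVHGen.perm]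
    simp only [Equiv.swap_apply_left, Equiv.swap_apply_right]
    simp only [← map_mul]
    exact hrel (.z_twist _ _ _)

/-- The action of `STVB n` on the presented monoid. -/
def act (n : ℕ) : STVB n →* Function.End (PresentedMonoid (STVHRel n)) :=
  PresentedMonoid.lift actGen actGen_rel

theorem act_rho (m : Fin (n - 1)) :
    act n (STVB.rho m) = permEnd n (Equiv.swap (crossLo m) (crossHi m)) := rfl

theorem act_strandPair {a : Fin (n - 1) → STVB n} {Y : ∀ k l : Fin n, k ≠ l → H}
    (hY : IsEquivariant Y)
    (ha : ∀ m, act n (a m) = mulLeft n (Y _ _ (STVB.crossLo_ne_crossHi m))) (k l : Fin n)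
    (h : k ≠ l) : act n (STVB.strandPair a k l h) = mulLeft n (Y k l h) := by
  induction k, l, h using STVB.pair_induction with
  | h₀ m => rw [STVB.strandPair_cross, ha]
  | h₀' m =>
    rw [STVB.strandPair_cross', map_mul, map_mul, ha, act_rho, swap_mul_mulLeft_mul_swap, hY]
    simp only [Equiv.swap_apply_left, Equiv.swap_apply_right]
  | h₁ k m h ih =>
    have h' := h.trans (STVB.crossLo_lt_crossHi m)
    rw [STVB.strandPair_crossHi a k m h, map_mul, map_mul, ih, act_rho,
      swap_mul_mulLeft_mul_swap, hY]
    simp only [Equiv.swap_apply_left, Equiv.swap_apply_of_ne_of_ne h.ne h'.ne]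
  | h₁' k m h ih =>
    have h' := h.trans (STVB.crossLo_lt_crossHi m)
    rw [STVB.strandPair_crossHi' a k m h, map_mul, map_mul, ih, act_rho,
      swap_mul_mulLeft_mul_swap, hY]
    simp only [Equiv.swap_apply_left, Equiv.swap_apply_of_ne_of_ne h.ne h'.ne]

theorem act_ofPresented (h : H) : act n (STVB.ofPresented n h) = mulLeft n h := by
  refine DFunLike.congr_fun (f := (act n).comp (STVB.ofPresented n)) (PresentedMonoid.ext _ ?_) h
  intro s
  cases s with
  | x k l h => exact act_strandPair isEquivariant_x (fun _ => rfl) k l h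
  | xInv k l h => exact act_strandPair isEquivariant_xInv (fun _ => rfl) k l h
  | z k l h => exact act_strandPair isEquivariant_z (fun _ => rfl) k l h
  | gamma j => rfl

/-- Evaluating the action of the image of `h` at `1` returns `h`. -/
theorem ofPresented_injective : Function.Injective (STVB.ofPresented n) := by
  intro h h' e
  have := congrFun (congrArg (act n) e) 1
  rw [act_ofPresented, act_ofPresented] at this
  change h * 1 = h' * 1 at this
  rwa [mul_one, mul_one] at this

end STVH

/-! ### Normal form for the Coxeter relations of type A -/

section Coxeter

/-- The product `q m * q (m - 1) * ⋯` of `d` factors. -/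
def descProd {Q : Type*} [Monoid Q] (q : ℕ → Q) (m : ℕ) : ℕ → Q
  | 0 => 1
  | d + 1 => descProd q m d * q (m - d)

variable {Q : Type*} [Monoid Q] {N : ℕ} {q : ℕ → Q}

theorem mul_descProd_comm (hcomm : ∀ i j, i + 1 < j → j < N → q i * q j = q j * q i)
    {m i : ℕ} (hm : m < N) (d : ℕ) (h : i + d < m + 1 ∧ (0 < d → i + d < m)) :
    q i * descProd q m d = descProd q m d * q i := by
  induction d with
  | zero => simp [descProd]
  | succ d ih =>
    rw [descProd, ← mul_assoc, ih (by omega), mul_assoc, hcomm i (m - d) (by omega) (by omega),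
      mul_assoc]

/-- Both `q (i + 1)` and `q i` occur in the product. The new factor commutes past the lower tail,
the braid relation turns `q (i + 1) * q i * q (i + 1)` into `q i * q (i + 1) * q i`, and the first
`q i` commutes past the upper head. -/
theorem descProd_mul (hcomm : ∀ i j, i + 1 < j → j < N → q i * q j = q j * q i)
    (hbraid : ∀ i, i + 1 < N → q i * q (i + 1) * q i = q (i + 1) * q i * q (i + 1))
    {m i : ℕ} (hm : m < N) (hi : i + 1 ≤ m) (d : ℕ) (hd : d ≤ m + 1) (h : m < i + d) :
    descProd q m d * q (i + 1) = q i * descProd q m d := by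
  induction d with
  | zero => omega
  | succ d ih =>
    by_cases hid : m < i + d
    · rw [descProd, mul_assoc, hcomm (m - d) (i + 1) (by omega) (by omega), ← mul_assoc,
        ih (by omega) hid, mul_assoc]
    · obtain ⟨d, rfl⟩ : ∃ e, d = e + 1 := ⟨d - 1, by omega⟩
      have e₁ : m - d = i + 1 := by omega
      have e₂ : m - (d + 1) = i := by omega
      rw [descProd, descProd, e₁, e₂]
      calc _ = descProd q m d * (q (i + 1) * q i * q (i + 1)) := by simp only [mul_assoc]
        _ = (descProd q m d * q i) * (q (i + 1) * q i) := by
          rw [← hbraid i (by omega)]; simp only [mul_assoc]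
        _ = _ := by
          rw [← mul_descProd_comm hcomm hm d (by omega)]; simp only [mul_assoc]

/-- Normal form for elements generated by Coxeter generators of type `A`. -/
theorem exists_eq_mul_descProd (hsq : ∀ i < N, q i * q i = 1)
    (hcomm : ∀ i j, i + 1 < j → j < N → q i * q j = q j * q i)
    (hbraid : ∀ i, i + 1 < N → q i * q (i + 1) * q i = q (i + 1) * q i * q (i + 1))
    {m : ℕ} (hm : m < N) {p : Q} (hp : p ∈ Submonoid.closure (q '' Set.Iio (m + 1))) :
    ∃ u ∈ Submonoid.closure (q '' Set.Iio m), ∃ d ≤ m + 1, p = u * descProd q m d := by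
  induction hp using Submonoid.closure_induction_right with
  | one => exact ⟨1, one_mem _, 0, by omega, by simp [descProd]⟩
  | mul_right p _ s hs ih =>
    obtain ⟨i, hi, rfl⟩ := hs
    obtain ⟨u, hu, d, hd, rfl⟩ := ih
    rw [Set.mem_Iio] at hi
    -- The last factor of the product has index `m - d + 1`. A smaller `i` commutes into `u` unless
    -- `i = m - d`, which lengthens the product; `i = m - d + 1` cancels the last factor; a larger
    -- `i` passes into `u` as `i - 1`.
    rcases Nat.lt_trichotomy (i + d) m with h | h | h
    · refine ⟨u * q i, mul_mem hu (Submonoid.subset_closure ⟨i, ?_, rfl⟩), d, hd, ?_⟩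
      · rw [Set.mem_Iio]; omega
      · rw [mul_assoc, mul_assoc, mul_descProd_comm hcomm hm d (by omega)]
    · refine ⟨u, hu, d + 1, by omega, ?_⟩
      rw [mul_assoc, descProd, show m - d = i by omega]
    · by_cases h' : i + d = m + 1
      · obtain ⟨d, rfl⟩ : ∃ e, d = e + 1 := ⟨d - 1, by omega⟩
        refine ⟨u, hu, d, by omega, ?_⟩
        rw [descProd, show m - d = i by omega, mul_assoc, mul_assoc, hsq i (by omega), mul_one]
      · obtain ⟨i, rfl⟩ : ∃ e, i = e + 1 := ⟨i - 1, by omega⟩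
        refine ⟨u * q i, mul_mem hu (Submonoid.subset_closure ⟨i, ?_, rfl⟩), d, hd, ?_⟩
        · rw [Set.mem_Iio]; omega
        · rw [mul_assoc, mul_assoc, descProd_mul hcomm hbraid hm (by omega) d hd (by omega)]

/-- Words in elements satisfying the relations of the adjacent transpositions are trivial if
the corresponding permutation is trivial. -/
theorem fst_eq_one_of_snd_fixes {M : Type*} [Monoid M] {N : ℕ} {r : ℕ → M}
    (hsq : ∀ i < N, r i * r i = 1)
    (hcomm : ∀ i j, i + 1 < j → j < N → r i * r j = r j * r i)
    (hbraid : ∀ i, i + 1 < N → r i * r (i + 1) * r i = r (i + 1) * r i * r (i + 1))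
    (m : ℕ) (hm : m ≤ N) (p : M × Equiv.Perm ℕ)
    (hp : p ∈ Submonoid.closure ((fun i => (r i, Equiv.swap i (i + 1))) '' Set.Iio m))
    (hfix : ∀ j ≤ m, p.2 j = j) : p.1 = 1 := by
  -- The normal form is applied in the product monoid, so that it holds for the word and for its
  -- permutation simultaneously.
  set q : ℕ → M × Equiv.Perm ℕ := fun i => (r i, Equiv.swap i (i + 1)) with hq
  have hsw : ∀ m k, Equiv.swap m (m + 1) k = if k = m then m + 1 else if k = m + 1 then m else k :=
    fun m k => Equiv.swap_apply_def m (m + 1) k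
  have hfar : ∀ m, ∀ u ∈ Submonoid.closure (q '' Set.Iio m), u.2 (m + 1) = m + 1 := by
    intro m u hu
    induction hu using Submonoid.closure_induction with
    | mem u hu =>
      obtain ⟨i, hi, rfl⟩ := hu
      rw [Set.mem_Iio] at hi
      simp only [hq, hsw]
      rw [if_neg (by omega), if_neg (by omega)]
    | one => rfl
    | mul u v _ _ hu hv => rw [Prod.snd_mul, Equiv.Perm.mul_apply, hv, hu]
  have hdesc : ∀ m d, d ≤ m + 1 → (descProd q m d).2 (m + 1 - d) = m + 1 := by
    intro m d
    induction d with
    | zero => intro _; rfl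
    | succ d ih =>
      intro hd
      rw [descProd, Prod.snd_mul, Equiv.Perm.mul_apply]
      simp only [hq, hsw]
      rw [if_pos (by omega), show m - d + 1 = m + 1 - d by omega]
      exact ih (by omega)
  induction m generalizing p with
  | zero =>
    have : p = 1 := by simpa using hp
    rw [this]; rfl
  | succ m ih =>
    have nf := exists_eq_mul_descProd (N := N) (q := q) ?_ ?_ ?_ hm hp
    · obtain ⟨u, hu, d, hd, rfl⟩ := nf
      -- The descending product sends `m + 1 - d` to `m + 1`, which `u` fixes. Since `m + 1 - d`
      -- must be fixed by the whole, `d = 0` and only `u` remains.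
      have h₁ := hfix (m + 1 - d) (by omega)
      rw [Prod.snd_mul, Equiv.Perm.mul_apply, hdesc m d hd, hfar m u hu] at h₁
      obtain rfl : d = 0 := by omega
      simp only [descProd, mul_one] at hfix ⊢
      exact ih (by omega) u (fun j hj => hfix j (by omega)) hu
    · intro i hi
      exact Prod.ext (hsq i hi) (Equiv.swap_mul_self _ _)
    · intro i j hij hj
      refine Prod.ext (hcomm i j hij hj) (Equiv.ext fun k => ?_)
      simp only [hq, Prod.snd_mul, Equiv.Perm.mul_apply, hsw]
      split_ifs <;> omega
    · intro i hi
      refine Prod.ext (hbraid i hi) ?_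
      simp only [hq, Prod.snd_mul]
      rw [Equiv.swap_mul_swap_mul_swap (by omega) (by omega), Equiv.swap_comm i,
        Equiv.swap_comm (i + 1) (i + 1 + 1),
        Equiv.swap_mul_swap_mul_swap (by omega) (by omega), Equiv.swap_comm]

end Coxeter

/-! ### Factorisation of elements, and the kernel of `φ₂` -/

namespace STVB

variable {n : ℕ}

theorem phi₂_rho (m : Fin (n - 1)) : phi₂ n (rho m) = Equiv.swap (crossLo m) (crossHi m) := rfl

theorem phi₂_strandPair {a : Fin (n - 1) → STVB n} (ha : ∀ m, phi₂ n (a m) = 1) (k l : Fin n)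
    (h : k ≠ l) : phi₂ n (strandPair a k l h) = 1 := by
  induction k, l, h using pair_induction with
  | h₀ m => rw [strandPair_cross, ha]
  | h₀' m => rw [strandPair_cross', map_mul, map_mul, ha, mul_one, ← map_mul, rho_mul_self, map_one]
  | h₁ k m h ih =>
    rw [strandPair_crossHi a k m h, map_mul, map_mul, ih, mul_one, ← map_mul, rho_mul_self, map_one]
  | h₁' k m h ih =>
    rw [strandPair_crossHi' a k m h, map_mul, map_mul, ih, mul_one, ← map_mul, rho_mul_self,
      map_one]

theorem phi₂_ofPresented (h : PresentedMonoid (STVHRel n)) : phi₂ n (ofPresented n h) = 1 := by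
  refine DFunLike.congr_fun (f := (phi₂ n).comp (ofPresented n)) (g := 1)
    (PresentedMonoid.ext _ ?_) h
  intro s
  cases s with
  | gamma j => rfl
  | _ k l h => exact phi₂_strandPair (fun _ => rfl) k l h

/-- The `ρ_i` satisfy the Coxeter relations of the symmetric group, so the permutation of a word in
them determines whether it is trivial. -/
theorem eq_one_of_phi₂_eq_one {w : STVB n} (hw : w ∈ Submonoid.closure (Set.range (rho (n := n))))
    (h : phi₂ n w = 1) : w = 1 := by
  let r : ℕ → STVB n := fun i => if h : i < n - 1 then rho ⟨i, h⟩ else 1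
  have hr : ∀ i (h : i < n - 1), r i = rho ⟨i, h⟩ := fun i h => dif_pos h
  -- A permutation of `ℕ` that comes from a word for `w` and agrees with `φ₂ w` on the strands, as
  -- `fst_eq_one_of_snd_fixes` requires.
  have key : ∃ π : Equiv.Perm ℕ, (w, π) ∈ Submonoid.closure
      ((fun i => (r i, Equiv.swap i (i + 1))) '' Set.Iio (n - 1)) ∧
      ∀ j : Fin n, π j = (phi₂ n w j : Fin n) := by
    clear h
    induction hw using Submonoid.closure_induction with
    | mem w hw =>
      obtain ⟨m, rfl⟩ := hw
      refine ⟨Equiv.swap (m : ℕ) (m + 1), Submonoid.subset_closure ⟨m, m.2, ?_⟩, fun j => ?_⟩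
      · simp only [hr m m.2]
      · rw [phi₂_rho, val_swap_cross]
    | one => exact ⟨1, one_mem _, fun j => by rw [map_one]; rfl⟩
    | mul v w _ _ hv hw =>
      obtain ⟨π, h₁, h₂⟩ := hv
      obtain ⟨ψ, h₃, h₄⟩ := hw
      refine ⟨π * ψ, mul_mem h₁ h₃, fun j => ?_⟩
      rw [Equiv.Perm.mul_apply, h₄, h₂, map_mul, Equiv.Perm.mul_apply]
  obtain ⟨π, hπ, hfix⟩ := key
  -- For `n = 0` the truncated `n - 1` is `0`, and the point `0` that has to be fixed is not a
  -- strand.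
  rcases Nat.eq_zero_or_pos n with rfl | hn
  · have : Set.range (rho (n := 0)) = ∅ :=
      Set.eq_empty_of_forall_notMem fun _ ⟨i, _⟩ => i.elim0
    simpa [this] using hw
  refine fst_eq_one_of_snd_fixes ?_ ?_ ?_ (n - 1) le_rfl _ hπ fun j hj => ?_
  · intro i hi
    rw [hr i hi, rho_mul_self]
  · intro i j hij hj
    rw [hr i (by omega), hr j hj, rho_comm _ _ (Or.inl hij)]
  · intro i hi
    rw [hr i (by omega), hr _ hi, rho_braid _ _ rfl]
  · have := hfix ⟨j, by omega⟩
    rwa [h] at this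

/-- The counterpart in `STVB n` of `permEnd_mul_mulLeft`; it moves `ρ_m` to the right of any element
coming from `H`. -/
theorem rho_mul_ofPresented (m : Fin (n - 1)) (h : PresentedMonoid (STVHRel n)) :
    rho m * ofPresented n h =
      ofPresented n (STVH.perm (Equiv.swap (crossLo m) (crossHi m)) h) * rho m := by
  have key : conjRho m (ofPresented n h) =
      ofPresented n (STVH.perm (Equiv.swap (crossLo m) (crossHi m)) h) := by
    refine DFunLike.congr_fun (f := (conjRho m).comp (ofPresented n))
      (g := (ofPresented n).comp (STVH.perm _)) (PresentedMonoid.ext _ ?_) h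
    intro s
    cases s with
    | x k l h => exact isCrossing_sigma.conj_rho h m
    | xInv k l h => exact isCrossing_sigmaInv.conj_rho h m
    | z k l h => exact isCrossing_tau.conj_rho h m
    | gamma j => exact conj_rho_gamma m j
  rw [← key]
  change _ = rho m * _ * rho m * rho m
  rw [mul_assoc _ (rho m), rho_mul_self, mul_one]

/-- By induction on a word, adding letters on the left: `σ_i^{±1}`, `τ_i`, `γ_j` are images of
generators of `H` and are absorbed, while `ρ_i` passes through and joins the right factor. -/
theorem exists_eq_ofPresented_mul (w : STVB n) : ∃ h : PresentedMonoid (STVHRel n),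
    ∃ r ∈ Submonoid.closure (Set.range (rho (n := n))), w = ofPresented n h * r := by
  have hw : w ∈ Submonoid.closure (Set.range (PresentedMonoid.of (STVBRel n))) := by
    rw [PresentedMonoid.closure_range_of]; trivial
  have hlift : ∀ (s : STVHGen n) (w : STVB n), (∃ h : PresentedMonoid (STVHRel n),
      ∃ r ∈ Submonoid.closure (Set.range (rho (n := n))), w = ofPresented n h * r) →
      ∃ h : PresentedMonoid (STVHRel n),
        ∃ r ∈ Submonoid.closure (Set.range (rho (n := n))), s.toSTVB * w = ofPresented n h * r := by
    rintro s w ⟨h, r, hr, rfl⟩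
    refine ⟨PresentedMonoid.of _ s * h, r, hr, ?_⟩
    rw [map_mul, mul_assoc]
    rfl
  induction hw using Submonoid.closure_induction_left with
  | one => exact ⟨1, 1, one_mem _, by rw [map_one, mul_one]⟩
  | mul_left s hs w _ ih =>
    obtain ⟨s, rfl⟩ := hs
    cases s with
    | sigma i =>
      have := hlift (.x _ _ (crossLo_ne_crossHi i)) w ih
      rwa [STVHGen.toSTVB, x, strandPair_cross] at this
    | sigmaInv i =>
      have := hlift (.xInv _ _ (crossLo_ne_crossHi i)) w ih
      rwa [STVHGen.toSTVB, xInv, strandPair_cross] at this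
    | tau i =>
      have := hlift (.z _ _ (crossLo_ne_crossHi i)) w ih
      rwa [STVHGen.toSTVB, z, strandPair_cross] at this
    | gamma j => exact hlift (.gamma j) w ih
    | rho i =>
      obtain ⟨h, r, hr, rfl⟩ := ih
      refine ⟨STVH.perm (Equiv.swap (crossLo i) (crossHi i)) h, rho i * r,
        mul_mem (Submonoid.subset_closure ⟨i, rfl⟩) hr, ?_⟩
      rw [← mul_assoc, ← mul_assoc, ← rho_mul_ofPresented]
      rfl

end STVB

theorem mainTheorem3 (n : ℕ) :
    ∃ e : PresentedMonoid (STVHRel n) ≃* STVB.STVH n,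
      ∀ a : STVHGen n, (e (PresentedMonoid.of (STVHRel n) a) : STVB n) = a.toSTVB := by
  refine ⟨MulEquiv.ofBijective ((STVB.ofPresented n).codRestrict (STVB.STVH n)
    STVB.phi₂_ofPresented) ⟨?_, ?_⟩, fun a => rfl⟩
  · intro h h' e
    exact STVH.ofPresented_injective (congrArg Subtype.val e)
  · rintro ⟨w, hw⟩
    -- The factor from `H` lies in the kernel, so `φ₂ r = 1`; this forces `r = 1`, and `h` is the
    -- preimage.
    obtain ⟨h, r, hr, rfl⟩ := STVB.exists_eq_ofPresented_mul w
    have h₁ : STVB.phi₂ n (STVB.ofPresented n h * r) = 1 := hw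
    rw [map_mul, STVB.phi₂_ofPresented, one_mul] at h₁
    refine ⟨h, Subtype.ext ?_⟩
    change STVB.ofPresented n h = STVB.ofPresented n h * r
    rw [STVB.eq_one_of_phi₂_eq_one hr h₁, mul_one]
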